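/- Let $d\in\mathbb N$ and let $\varphi_1,\dots,\varphi_m:\mathbb R^d\to\mathbb R^d$ be similitudes with ratios in $(0,1)$, that is, for each $i$ there is $r_i\in(0,1)$ with $|\varphi_i(x)-\varphi_i(y)|=r_i|x-y|$ for all $x,y\in\mathbb R^d$. Let $C\subset\mathbb R^d$ be the self-similar set they generate, i.e. the non-empty compact set with $C=\varphi_1(C)\cup\dots\cup\varphi_m(C)$. Suppose that the strong separation condition holds, i.e. the sets $\varphi_1(C),\dots,\varphi_m(C)$ are pairwise disjoint, and that $C$ is not contained in any affine hyperplane of $\mathbb R^d$. Let $s=\dim_H C$ be the Hausdorff dimension of $C$ and let $\mathcal H^s$ be the $s$-dimensional Hausdorff measure on $\mathbb R^d$. For $x\in C$ and $t\in\mathbb R$ write $e^{t}C^x=\{e^{t}(y-x): y\in C\}$. Equip the family $\Gamma$ of all closed subsets of $\mathbb R^d$ (including $\emptyset$) with the Fell topology, which is generated by the sets $\{F\in\Gamma: F\cap K=\emptyset\}$ with $K\subset\mathbb R^d$ compact and $\{F\in\Gamma: F\cap G\neq\emptyset\}$ with $G\subset\mathbb R^d$ open. Let $x\in C$, let $(t_k)$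 be a sequence of real numbers with $t_k\to\infty$, and suppose that $e^{t_k}C^x$ converges to $F\in\Gamma$ in the Fell topology. Then there is a strictly increasing sequence of indices $(k_j)_{j\ge 1}$ such that $$\mathcal H^s\lfloor_{e^{t_{k_j}}C^x}\ \longrightarrow\ \mathcal H^s\lfloor_F \quad\text{weakly as } j\to\infty,$$ that is, all the measures $\mathcal H^s\lfloor_{e^{t_{k_j}}C^x}$ and $\mathcal H^s\lfloor_F$ are Radon measures on $\mathbb R^d$, and $\int f\,d\mathcal H^s\lfloor_{e^{t_{k_j}}C^x}\to\int f\,d\mathcal H^s\lfloor_F$ for every compactly supported continuous function $f:\mathbb R^d\to\mathbb R$. -/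

import Mathlib

open Set Filter Topology MeasureTheory TopologicalSpace

/-- A contracting similitude: all distances are multiplied by one ratio `0 < r < 1`. -/
def IsSimilitude {E : Type*} [MetricSpace E] (f : E → E) : Prop :=
  ∃ r : ℝ, 0 < r ∧ r < 1 ∧ ∀ x y, dist (f x) (f y) = r * dist x y

/-- `C` is the self-similar set generated by the finite family `φ`: the family consists of
contracting similitudes, and `C` is the non-empty compact set with `C = ⋃ i, φ i (C)`. -/
structure IsSelfSimilarSet {E : Type*} [MetricSpace E] {m : ℕ} (φ : Fin m → E → E)
    (C : Set E) : Prop where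
  similitude : ∀ i, IsSimilitude (φ i)
  nonempty : C.Nonempty
  isCompact : IsCompact C
  eq_iUnion : C = ⋃ i, φ i '' C

/-- The strong separation condition: the parts `φ i (C)` are pairwise disjoint. -/
def StrongSeparation {E : Type*} {m : ℕ} (φ : Fin m → E → E) (C : Set E) : Prop :=
  ∀ i j, i ≠ j → Disjoint (φ i '' C) (φ j '' C)

/-- An affine hyperplane: a non-empty affine subspace of codimension one. -/
def IsHyperplane {E : Type*} [NormedAddCommGroup E] [NormedSpace ℝ E]
    (P : AffineSubspace ℝ E) : Prop :=
  (P : Set E).Nonempty ∧ Module.finrank ℝ P.direction + 1 = Module.finrank ℝ E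

/-- The Fell (hit-and-miss) topology on the closed subsets of `E`, the empty set included: it is
generated by the families `{F | F ∩ K = ∅}`, `K` compact, and `{F | F ∩ G ≠ ∅}`, `G` open. -/
abbrev fellTopology (E : Type*) [TopologicalSpace E] : TopologicalSpace (Closeds E) :=
  generateFrom
    ({S | ∃ K : Set E, IsCompact K ∧ S = {F : Closeds E | (F : Set E) ∩ K = ∅}} ∪
      {S | ∃ G : Set E, IsOpen G ∧ S = {F : Closeds E | ((F : Set E) ∩ G).Nonempty}})

/-- The magnified closed set `e ^ t (C - x) = {e ^ t (y - x) | y ∈ C}`. -/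
def blowUp {E : Type*} [NormedAddCommGroup E] [NormedSpace ℝ E]
    (C : Closeds E) (x : E) (t : ℝ) : Closeds E where
  carrier := (fun y => Real.exp t • (y - x)) '' (C : Set E)
  isClosed' :=
    ((Homeomorph.subRight x).trans
      (Homeomorph.smulOfNeZero (Real.exp t) (Real.exp_ne_zero t))).isClosedMap _ C.isClosed

/-- Weak convergence of Radon measures: all the measures are Radon, and the integrals of every
compactly supported continuous real-valued function converge. -/
structure RadonWeakTendsto {E : Type*} [TopologicalSpace E] [MeasurableSpace E]
    (μ : ℕ → Measure E) (ν : Measure E) : Prop where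
  radon : ∀ k, (μ k).Regular
  radon_limit : ν.Regular
  tendsto_integral : ∀ f : E → ℝ, Continuous f → HasCompactSupport f →
    Tendsto (fun k => ∫ y, f y ∂(μ k)) atTop (𝓝 (∫ y, f y ∂ν))

/-! Fix a ball about the origin. For large `t` the blow-up coincides in it with a similar copy of
`C`, whose ratio lies in a compact subinterval of `(0, ∞)` independent of `t`: follow the nested
pieces containing `x` down to the size of the window and use the gap between pieces
(`exists_scalesBy_inter_ball_subset`, `eventually_exists_blowUp_inter_ball_eq`). By Arzelà–Ascoli
the parametrisations of these copies by `C` subconverge uniformly, and the Fell limit `F` must agree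
in the ball with the limiting copy (`inter_eq_of_tendsto_fell`). On a copy of ratio `ρ`, `μH[s]` is
`ρ ^ s` times the push-forward of `μH[s]` on `C`, so the integrals converge by dominated
convergence.

This needs `μH[s] C < ⊤`. If `∑ r i ^ s ≤ 1`, iterated pieces are efficient covers. If the sum
exceeded `1`, it would still do so for some `p > s`, giving `μH[p] C > 0` above the dimension. -/

open scoped NNReal ENNReal

/-! ### Maps scaling distances -/

/-- The map `f` multiplies all distances by `r`. -/
def ScalesBy {X Y : Type*} [MetricSpace X] [MetricSpace Y] (f : X → Y) (r : ℝ≥0) : Prop :=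
  ∀ x y, dist (f x) (f y) = r * dist x y

namespace ScalesBy

variable {X Y Z : Type*} [MetricSpace X] [MetricSpace Y] [MetricSpace Z]
  {f : X → Y} {g : Y → Z} {r q : ℝ≥0}

theorem lipschitz (h : ScalesBy f r) : LipschitzWith r f :=
  LipschitzWith.of_dist_le_mul fun x y => (h x y).le

theorem antilipschitz (h : ScalesBy f r) (hr : r ≠ 0) : AntilipschitzWith r⁻¹ f :=
  AntilipschitzWith.of_le_mul_dist fun x y => by
    have : (r : ℝ) ≠ 0 := by exact_mod_cast hr
    rw [h x y, NNReal.coe_inv, inv_mul_cancel_left₀ this]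

theorem comp (hg : ScalesBy g q) (hf : ScalesBy f r) : ScalesBy (g ∘ f) (q * r) := fun x y => by
  simp [hg (f x) (f y), hf x y, mul_assoc]

theorem mul_ediam_preimage_le (h : ScalesBy f r) (hr : r ≠ 0) (s : Set Y) :
    (r : ℝ≥0∞) * Metric.ediam (f ⁻¹' s) ≤ Metric.ediam s := by
  have h1 := (h.antilipschitz hr).ediam_preimage_le s
  calc (r : ℝ≥0∞) * Metric.ediam (f ⁻¹' s) ≤ r * ((r⁻¹ : ℝ≥0) * Metric.ediam s) := by gcongr
    _ = Metric.ediam s := by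
      rw [← mul_assoc, ← ENNReal.coe_mul, mul_inv_cancel₀ hr, ENNReal.coe_one, one_mul]

theorem hausdorffMeasure_image [MeasurableSpace X] [BorelSpace X] [MeasurableSpace Y]
    [BorelSpace Y] (h : ScalesBy f r) (hr : r ≠ 0) {s : ℝ} (hs : 0 ≤ s) (A : Set X) :
    μH[s] (f '' A) = (r : ℝ≥0∞) ^ s * μH[s] A := by
  refine le_antisymm (h.lipschitz.hausdorffMeasure_image_le hs A) ?_
  have h1 := (h.antilipschitz hr).le_hausdorffMeasure_image hs A
  calc (r : ℝ≥0∞) ^ s * μH[s] A ≤ r ^ s * (((r⁻¹ : ℝ≥0) : ℝ≥0∞) ^ s * μH[s] (f '' A)) := by gcongr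
    _ = μH[s] (f '' A) := by
      rw [← mul_assoc, ← ENNReal.mul_rpow_of_nonneg _ _ hs, ← ENNReal.coe_mul,
        mul_inv_cancel₀ hr, ENNReal.coe_one, ENNReal.one_rpow, one_mul]

end ScalesBy

/-! ### Finiteness of the Hausdorff measure of `C` -/

section Dimension

variable {X : Type*} [MetricSpace X] {m : ℕ} {φ : Fin m → X → X} {r : Fin m → ℝ≥0} {C : Set X}

/-- A lower bound for the sums over finite covers of a strongly separated self-similar set. -/
theorem rpow_le_sum_ediam_rpow (hφ : ∀ i, ScalesBy (φ i) (r i)) (hr : ∀ i, r i ≠ 0)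
    (hne : C.Nonempty) (hsub : ∀ i, ∀ c ∈ C, φ i c ∈ C) {δ : ℝ≥0}
    (hδ : ∀ i j, i ≠ j → ∀ y ∈ C, ∀ z ∈ C, (δ : ℝ) ≤ dist (φ i y) (φ j z))
    (hm : 2 ≤ m) {p : ℝ} (hp : 0 < p) (hsum : 1 ≤ ∑ i, (r i : ℝ≥0∞) ^ p) (n : ℕ) :
    ∀ (T : Finset ℕ) (U : ℕ → Set X), T.card ≤ n → C ⊆ ⋃ j ∈ T, U j →
      (δ : ℝ≥0∞) ^ p ≤ ∑ j ∈ T, Metric.ediam (U j) ^ p := by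
  classical
  induction n with
  | zero =>
    intro T U hT hU
    obtain rfl : T = ∅ := by simpa using hT
    obtain ⟨c, hc⟩ := hne
    simpa using hU hc
  | succ n ih =>
    intro T U hT hU
    by_contra! hlt
    have hsmall : ∀ j ∈ T, Metric.ediam (U j) < δ := by
      intro j hj
      refine lt_of_not_ge fun hge => hlt.not_ge ?_
      calc (δ : ℝ≥0∞) ^ p ≤ Metric.ediam (U j) ^ p := by gcongr
        _ ≤ _ := Finset.single_le_sum (f := fun j => Metric.ediam (U j) ^ p)
          (fun _ _ => zero_le) hj
    -- Sets of diameter below `δ` meet at most one piece, so the cover splits into disjoint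
    -- subfamilies, one per piece; each pulls back to a cover of `C`.
    let S : Fin m → Finset ℕ := fun i => T.filter fun j => (U j ∩ φ i '' C).Nonempty
    have hdisj : ∀ i i', i ≠ i' → Disjoint (S i) (S i') := by
      intro i i' hii
      rw [Finset.disjoint_left]
      intro j hj hj'
      obtain ⟨hjT, _, hy, y, hyC, rfl⟩ := Finset.mem_filter.1 hj
      obtain ⟨-, _, hz, z, hzC, rfl⟩ := Finset.mem_filter.1 hj'
      have h1 : edist (φ i y) (φ i' z) < δ :=
        (Metric.edist_le_ediam_of_mem hy hz).trans_lt (hsmall j hjT)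
      rw [edist_nndist, ENNReal.coe_lt_coe, ← NNReal.coe_lt_coe, coe_nndist] at h1
      exact h1.not_ge (hδ i i' hii y hyC z hzC)
    have hcov : ∀ i, C ⊆ ⋃ j ∈ S i, φ i ⁻¹' U j := by
      intro i c hc
      obtain ⟨j, hjT, hj⟩ := mem_iUnion₂.1 (hU (hsub i c hc))
      exact mem_iUnion₂.2 ⟨j, Finset.mem_filter.2 ⟨hjT, _, hj, c, hc, rfl⟩, hj⟩
    have hSne : ∀ i, (S i).Nonempty := by
      intro i
      obtain ⟨c, hc⟩ := hne
      obtain ⟨j, hj, -⟩ := mem_iUnion₂.1 (hcov i hc)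
      exact ⟨j, hj⟩
    -- A second piece uses up at least one set, so each subfamily is strictly smaller and the
    -- induction applies.
    have hcard : ∀ i, (S i).card ≤ n := by
      intro i
      have : Nontrivial (Fin m) := Fin.nontrivial_iff_two_le.2 hm
      obtain ⟨i', hi'⟩ := exists_ne i
      have h1 : (S i ∪ S i').card ≤ T.card :=
        Finset.card_le_card (Finset.union_subset (Finset.filter_subset _ _)
          (Finset.filter_subset _ _))
      rw [Finset.card_union_of_disjoint (hdisj i i' hi'.symm)] at h1
      have := (hSne i').card_pos
      omega
    refine hlt.not_ge ?_
    calc (δ : ℝ≥0∞) ^ p ≤ (∑ i, (r i : ℝ≥0∞) ^ p) * (δ : ℝ≥0∞) ^ p := le_mul_of_one_le_left' hsum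
      _ = ∑ i, (r i : ℝ≥0∞) ^ p * (δ : ℝ≥0∞) ^ p := Finset.sum_mul _ _ _
      _ ≤ ∑ i, ∑ j ∈ S i, Metric.ediam (U j) ^ p := by
        refine Finset.sum_le_sum fun i _ => ?_
        calc _ ≤ (r i : ℝ≥0∞) ^ p * ∑ j ∈ S i, Metric.ediam (φ i ⁻¹' U j) ^ p := by
              gcongr
              exact ih (S i) _ (hcard i) (hcov i)
          _ ≤ _ := by
              rw [Finset.mul_sum]
              refine Finset.sum_le_sum fun j _ => ?_
              rw [← ENNReal.mul_rpow_of_nonneg _ _ hp.le]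
              gcongr
              exact (hφ i).mul_ediam_preimage_le (hr i) _
      _ = ∑ j ∈ Finset.univ.biUnion S, Metric.ediam (U j) ^ p :=
        (Finset.sum_biUnion fun i _ i' _ h => hdisj i i' h).symm
      _ ≤ _ := Finset.sum_le_sum_of_subset
        (Finset.biUnion_subset.2 fun i _ => Finset.filter_subset _ _)

/-- A set is contained in an open set of nearly the same diameter. -/
theorem exists_isOpen_ediam_rpow_le (A : Set X) {p : ℝ} (hp : 0 < p) {ε : ℝ≥0∞} (hε : ε ≠ 0) :
    ∃ V, IsOpen V ∧ A ⊆ V ∧ Metric.ediam V ^ p ≤ Metric.ediam A ^ p + ε := by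
  by_cases hA : Metric.ediam A = ⊤
  · exact ⟨univ, isOpen_univ, subset_univ _, by simp [hA, hp]⟩
  have hlim : Tendsto (fun η : ℝ≥0 => (Metric.ediam A + 2 * (η : ℝ≥0∞)) ^ p) (𝓝 0)
      (𝓝 (Metric.ediam A ^ p)) := by
    have h1 : Tendsto (fun η : ℝ≥0 => Metric.ediam A + 2 * (η : ℝ≥0∞)) (𝓝 0)
        (𝓝 (Metric.ediam A + 2 * ((0 : ℝ≥0) : ℝ≥0∞))) :=
      tendsto_const_nhds.add (ENNReal.Tendsto.const_mul
        (ENNReal.tendsto_coe.2 tendsto_id) (Or.inr (by simp)))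
    simpa using h1.ennrpow_const p
  have hlt : Metric.ediam A ^ p < Metric.ediam A ^ p + ε :=
    ENNReal.lt_add_right (by simp [hA, hp.le]) hε
  obtain ⟨η, hη, hη0⟩ := (((hlim.eventually_lt_const hlt).filter_mono
    nhdsWithin_le_nhds).and (self_mem_nhdsWithin : Ioi (0 : ℝ≥0) ∈ 𝓝[>] 0)).exists
  refine ⟨Metric.thickening η A, Metric.isOpen_thickening,
    Metric.self_subset_thickening (by exact_mod_cast hη0) A, le_trans ?_ hη.le⟩
  gcongr
  exact Metric.ediam_thickening_le η

variable [MeasurableSpace X] [BorelSpace X]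

theorem hausdorffMeasure_pos_of_one_le_sum (hφ : ∀ i, ScalesBy (φ i) (r i)) (hr : ∀ i, r i ≠ 0)
    (hC : IsCompact C) (hne : C.Nonempty) (hsub : ∀ i, ∀ c ∈ C, φ i c ∈ C) {δ : ℝ≥0} (hδ0 : 0 < δ)
    (hδ : ∀ i j, i ≠ j → ∀ y ∈ C, ∀ z ∈ C, (δ : ℝ) ≤ dist (φ i y) (φ j z))
    (hm : 2 ≤ m) {p : ℝ} (hp : 0 < p) (hsum : 1 ≤ ∑ i, (r i : ℝ≥0∞) ^ p) :
    0 < μH[p] C := by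
  have hδp : 0 < (δ : ℝ≥0∞) ^ p := ENNReal.rpow_pos (by exact_mod_cast hδ0) (by simp)
  refine hδp.trans_le ?_
  rw [Measure.hausdorffMeasure_apply]
  -- The bound holds for covers of any mesh, so the mesh `1` is arbitrary.
  refine le_trans ?_ (le_iSup₂ (1 : ℝ≥0∞) zero_lt_one)
  refine le_iInf fun t => le_iInf fun ht => le_iInf fun _ => ?_
  refine ENNReal.le_of_forall_pos_le_add fun ε hε _ => ?_
  obtain ⟨ε', hε', hε'sum⟩ := ENNReal.exists_pos_sum_of_countable'
    (ENNReal.coe_pos.2 hε).ne' ℕ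
  choose V hVo hVs hVd using fun n => exists_isOpen_ediam_rpow_le (t n) hp (hε' n).ne'
  obtain ⟨T, hT⟩ := hC.elim_finite_subcover V hVo (ht.trans (iUnion_mono hVs))
  have hterm : ∀ n, Metric.ediam (t n) ^ p ≤ ⨆ _ : (t n).Nonempty, Metric.ediam (t n) ^ p := by
    intro n
    rcases (t n).eq_empty_or_nonempty with h | h
    · simp [h, hp]
    · exact le_iSup_of_le h le_rfl
  calc (δ : ℝ≥0∞) ^ p ≤ ∑ j ∈ T, Metric.ediam (V j) ^ p :=
        rpow_le_sum_ediam_rpow hφ hr hne hsub hδ hm hp hsum _ T V le_rfl hT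
    _ ≤ ∑' j, Metric.ediam (V j) ^ p := ENNReal.sum_le_tsum T
    _ ≤ ∑' j, ((⨆ _ : (t j).Nonempty, Metric.ediam (t j) ^ p) + ε' j) :=
        ENNReal.tsum_le_tsum fun j => (hVd j).trans (by gcongr; exact hterm j)
    _ ≤ _ := by
        rw [ENNReal.tsum_add]
        gcongr

/-- The `n`-fold images of `C` form covers whose mesh decays like `q ^ n`, while passing to the next
level does not increase the bound on the sum of `s`-th powers of diameters. -/
theorem hausdorffMeasure_lt_top_of_sum_le_one (hφ : ∀ i, ScalesBy (φ i) (r i))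
    (hr1 : ∀ i, r i < 1) (hC : IsCompact C) (heq : C ⊆ ⋃ i, φ i '' C) {s : ℝ} (hs : 0 ≤ s)
    (hsum : ∑ i, (r i : ℝ≥0∞) ^ s ≤ 1) : μH[s] C < ⊤ := by
  obtain ⟨q, hq1, hq⟩ : ∃ q : ℝ≥0, q < 1 ∧ ∀ i, r i ≤ q := by
    refine ⟨Finset.univ.sup r, (Finset.sup_lt_iff zero_lt_one).2 fun i _ => hr1 i,
      fun i => Finset.le_sup (Finset.mem_univ i)⟩
  have hcov : ∀ n : ℕ, ∃ (ι : Type) (_ : Fintype ι) (U : ι → Set X), C ⊆ ⋃ a, U a ∧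
      (∀ a, Metric.ediam (U a) ≤ q ^ n * Metric.ediam C) ∧
      ∑ a, Metric.ediam (U a) ^ s ≤ Metric.ediam C ^ s := by
    intro n
    induction n with
    | zero => exact ⟨Unit, inferInstance, fun _ => C, fun c hc => mem_iUnion.2 ⟨(), hc⟩, by simp, by simp⟩
    | succ n ih =>
      obtain ⟨ι, _, U, hU, hd, hsm⟩ := ih
      have himg : ∀ i a, Metric.ediam (φ i '' U a) ≤ r i * Metric.ediam (U a) := fun i a =>
        (hφ i).lipschitz.ediam_image_le _
      refine ⟨Fin m × ι, inferInstance, fun a => φ a.1 '' U a.2, ?_, ?_, ?_⟩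
      · intro c hc
        obtain ⟨i, y, hy, rfl⟩ := mem_iUnion.1 (heq hc)
        obtain ⟨a, ha⟩ := mem_iUnion.1 (hU hy)
        exact mem_iUnion.2 ⟨(i, a), y, ha, rfl⟩
      · rintro ⟨i, a⟩
        calc _ ≤ (r i : ℝ≥0∞) * Metric.ediam (U a) := himg i a
          _ ≤ q * (q ^ n * Metric.ediam C) := by
            gcongr
            exacts [hq i, hd a]
          _ = _ := by rw [pow_succ', mul_assoc]
      · rw [Fintype.sum_prod_type]
        calc _ ≤ ∑ i, ∑ a, (r i : ℝ≥0∞) ^ s * Metric.ediam (U a) ^ s := by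
              gcongr with i _ a _
              rw [← ENNReal.mul_rpow_of_nonneg _ _ hs]
              gcongr
              exact himg i a
          _ = (∑ i, (r i : ℝ≥0∞) ^ s) * ∑ a, Metric.ediam (U a) ^ s := by
              simp_rw [← Finset.mul_sum, Finset.sum_mul]
          _ ≤ 1 * Metric.ediam C ^ s := by gcongr
          _ = _ := one_mul _
  choose ι hι U hU hd hsm using hcov
  have hdiam : Metric.ediam C ≠ ⊤ := hC.isBounded.ediam_ne_top
  have hlim : Tendsto (fun n : ℕ => (q : ℝ≥0∞) ^ n * Metric.ediam C) atTop (𝓝 0) := by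
    have h0 := ENNReal.tendsto_pow_atTop_nhds_zero_of_lt_one (r := (q : ℝ≥0∞))
      (by exact_mod_cast hq1)
    simpa using ENNReal.Tendsto.mul_const h0 (Or.inr hdiam)
  refine (Measure.hausdorffMeasure_le_liminf_sum s C _ hlim U (Eventually.of_forall hd)
    (Eventually.of_forall hU)).trans_lt ?_
  calc liminf (fun n => ∑ a, Metric.ediam (U n a) ^ s) atTop
      ≤ liminf (fun _ : ℕ => Metric.ediam C ^ s) atTop :=
        liminf_le_liminf (Eventually.of_forall hsm)
    _ = Metric.ediam C ^ s := liminf_const _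
    _ < ⊤ := ENNReal.rpow_lt_top_of_nonneg hs hdiam

/-- A strongly separated self-similar set has finite Hausdorff measure in its dimension. -/
theorem hausdorffMeasure_dimH_lt_top (hφ : ∀ i, ScalesBy (φ i) (r i)) (hr : ∀ i, r i ≠ 0)
    (hr1 : ∀ i, r i < 1) (hC : IsCompact C) (hne : C.Nonempty) (heq : C = ⋃ i, φ i '' C)
    {δ : ℝ≥0} (hδ0 : 0 < δ)
    (hδ : ∀ i j, i ≠ j → ∀ y ∈ C, ∀ z ∈ C, (δ : ℝ) ≤ dist (φ i y) (φ j z))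
    (hdim : dimH C ≠ ⊤) : μH[(dimH C).toReal] C < ⊤ := by
  set s := (dimH C).toReal with hs
  have hs0 : 0 ≤ s := ENNReal.toReal_nonneg
  rcases le_or_gt (∑ i, (r i : ℝ≥0∞) ^ s) 1 with hle | hgt
  · exact hausdorffMeasure_lt_top_of_sum_le_one hφ hr1 hC heq.subset hs0 hle
  -- Continuity in the exponent yields `p > s` with sum still above `1`; then `μH[p] C` would be
  -- both positive and zero.
  exfalso
  have hm : 2 ≤ m := by
    have h1 : ∑ i, (r i : ℝ≥0∞) ^ s ≤ m := by
      calc _ ≤ ∑ _i : Fin m, (1 : ℝ≥0∞) := Finset.sum_le_sum fun i _ =>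
            ENNReal.rpow_le_one (by exact_mod_cast (hr1 i).le) hs0
        _ = m := by simp
    exact_mod_cast hgt.trans_le h1
  have hcont : Continuous fun p : ℝ => ∑ i, (r i : ℝ) ^ p :=
    continuous_finsetSum _ fun i _ =>
      Real.continuous_const_rpow (by exact_mod_cast hr i)
  have hcast : ∀ p : ℝ, ∑ i, (r i : ℝ≥0∞) ^ p = ENNReal.ofReal (∑ i, (r i : ℝ) ^ p) := by
    intro p
    rw [ENNReal.ofReal_sum_of_nonneg fun i _ => by positivity]
    refine Finset.sum_congr rfl fun i _ => ?_
    rw [← ENNReal.ofReal_rpow_of_pos (by exact_mod_cast pos_iff_ne_zero.2 (hr i)),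
      ENNReal.ofReal_coe_nnreal]
  rw [hcast, ENNReal.one_lt_ofReal] at hgt
  obtain ⟨p, hp1, hps⟩ := (((hcont.tendsto s).eventually_const_lt hgt).filter_mono
    nhdsWithin_le_nhds |>.and (self_mem_nhdsWithin : Ioi s ∈ 𝓝[>] s)).exists
  have hp0 : 0 < p := hs0.trans_lt hps
  have hpos := hausdorffMeasure_pos_of_one_le_sum hφ hr hC hne
    (fun i c hc => heq ▸ mem_iUnion.2 ⟨i, c, hc, rfl⟩) hδ0 hδ hm hp0
    (by rw [hcast, ENNReal.one_le_ofReal]; exact hp1.le)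
  refine hpos.ne' ?_
  lift p to ℝ≥0 using hp0.le
  refine hausdorffMeasure_of_dimH_lt ?_
  rw [← ENNReal.ofReal_coe_nnreal]
  exact (ENNReal.lt_ofReal_iff_toReal_lt hdim).2 hps

end Dimension

/-! ### Isolated copies of `C` around a point -/

section Pieces

variable {X : Type*} [MetricSpace X] {m : ℕ} {φ : Fin m → X → X} {r : Fin m → ℝ≥0} {C : Set X}

theorem StrongSeparation.exists_le_dist (hsep : StrongSeparation φ C) (hC : IsCompact C)
    (hφ : ∀ i, Continuous (φ i)) :
    ∃ δ : ℝ≥0, 0 < δ ∧ ∀ i j, i ≠ j → ∀ y ∈ C, ∀ z ∈ C, (δ : ℝ) ≤ dist (φ i y) (φ j z) := by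
  have key : ∀ i j, ∀ᶠ δ : ℝ≥0 in 𝓝[>] 0, i ≠ j → ∀ y ∈ C, ∀ z ∈ C,
      (δ : ℝ) ≤ dist (φ i y) (φ j z) := by
    intro i j
    by_cases hij : i = j
    · exact Eventually.of_forall fun _ h => absurd hij h
    obtain ⟨η, hη, hd⟩ := (hsep i j hij).exists_thickenings (hC.image (hφ i))
      (hC.image (hφ j)).isClosed
    filter_upwards [nhdsWithin_le_nhds (Iio_mem_nhds (Real.toNNReal_pos.2 hη))] with δ hδ _ y hy z hz
    have hδ' : (δ : ℝ) < η := (Real.lt_toNNReal_iff_coe_lt).1 hδ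
    by_contra! hlt
    exact disjoint_left.1 hd (Metric.self_subset_thickening hη _ (mem_image_of_mem _ hy))
      (Metric.mem_thickening_iff.2 ⟨_, mem_image_of_mem _ hz, hlt.trans hδ'⟩)
  obtain ⟨δ, h1, h2⟩ := ((eventually_all.2 fun i => eventually_all.2 (key i)).and
    (self_mem_nhdsWithin : Ioi (0 : ℝ≥0) ∈ 𝓝[>] 0)).exists
  exact ⟨δ, h2, h1⟩

/-- Around each point, at each scale `q ≤ 1`, a strongly separated self-similar set
coincides with a similar copy of itself of comparable size. -/
theorem exists_scalesBy_inter_ball_subset (hφ : ∀ i, ScalesBy (φ i) (r i)) (hr1 : ∀ i, r i < 1)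
    (heq : C = ⋃ i, φ i '' C) {δ a : ℝ≥0}
    (hδ : ∀ i j, i ≠ j → ∀ y ∈ C, ∀ z ∈ C, (δ : ℝ) ≤ dist (φ i y) (φ j z))
    (ha : 0 < a) (har : ∀ i, a ≤ r i) {x : X} (hx : x ∈ C) {q : ℝ≥0} (hq : 0 < q) (hq1 : q ≤ 1) :
    ∃ (g : X → X) (ρ : ℝ≥0), q ≤ ρ ∧ ρ ≤ q / a ∧ ScalesBy g ρ ∧ x ∈ g '' C ∧ g '' C ⊆ C ∧
      C ∩ Metric.ball x (δ * ρ) ⊆ g '' C := by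
  obtain ⟨b, hb1, hb⟩ : ∃ b : ℝ≥0, b < 1 ∧ ∀ i, r i ≤ b :=
    ⟨Finset.univ.sup r, (Finset.sup_lt_iff zero_lt_one).2 fun i _ => hr1 i,
      fun i => Finset.le_sup (Finset.mem_univ i)⟩
  -- Descent along the pieces containing `x`: the disjunction says that the descent either has made
  -- `n` steps or has come within a factor `1 / a` of the scale `q`. Since `b ^ n → 0`, it must
  -- stop.
  have key : ∀ n : ℕ, ∃ (g : X → X) (ρ : ℝ≥0), q ≤ ρ ∧ (ρ ≤ b ^ n ∨ ρ ≤ q / a) ∧ ScalesBy g ρ ∧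
      x ∈ g '' C ∧ g '' C ⊆ C ∧ C ∩ Metric.ball x (δ * ρ) ⊆ g '' C := by
    intro n
    induction n with
    | zero =>
      exact ⟨id, 1, hq1, Or.inl (by simp), fun y z => by simp, by simpa using hx, by simp, by simp⟩
    | succ n ih =>
      obtain ⟨g, ρ, hqρ, hρ, hg, hxg, hgC, hball⟩ := ih
      obtain ⟨c, hc, rfl⟩ := hxg
      obtain ⟨i, c', hc', rfl⟩ := mem_iUnion.1 (heq.subset hc)
      by_cases hlt : ρ * r i < q
      · refine ⟨g, ρ, hqρ, Or.inr ?_, hg, ⟨_, hc, rfl⟩, hgC, hball⟩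
        rw [le_div_iff₀ ha]
        exact (mul_le_mul_right (har i) ρ).trans hlt.le
      · refine ⟨g ∘ φ i, ρ * r i, not_lt.1 hlt, ?_, hg.comp (hφ i), ⟨c', hc', rfl⟩, ?_, ?_⟩
        · rcases hρ with h | h
          · left
            rw [pow_succ]
            exact mul_le_mul' h (hb i)
          · right
            exact (mul_le_of_le_one_right' (hr1 i).le).trans h
        · rintro _ ⟨y, hy, rfl⟩
          exact hgC ⟨φ i y, heq ▸ mem_iUnion.2 ⟨i, y, hy, rfl⟩, rfl⟩
        · rintro y ⟨hyC, hy⟩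
          have hρ0 : (0 : ℝ) < ρ := by exact_mod_cast hq.trans_le hqρ
          have hyρ : dist y (g (φ i c')) < δ * ρ := by
            refine (Metric.mem_ball.1 hy).trans_le ?_
            have : (r i : ℝ) ≤ 1 := by exact_mod_cast (hr1 i).le
            push_cast
            gcongr
            exact mul_le_of_le_one_right hρ0.le this
          obtain ⟨e, he, rfl⟩ := hball ⟨hyC, hyρ⟩
          obtain ⟨j, e', he', rfl⟩ := mem_iUnion.1 (heq.subset he)
          -- The map `g` enlarges the gap `δ` between pieces to `δ * ρ`, so the ball meets only the
          -- sub-piece containing `x`.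
          obtain rfl : j = i := by
            by_contra hji
            have := hδ j i hji e' he' c' hc'
            rw [hg, mul_comm] at hyρ
            exact (lt_of_mul_lt_mul_right hyρ hρ0.le).not_ge this
          exact ⟨e', he', rfl⟩
  obtain ⟨n, hn⟩ := exists_pow_lt_of_lt_one hq hb1
  obtain ⟨g, ρ, hqρ, hρ | hρ, h⟩ := key n
  · exact absurd (hqρ.trans hρ) hn.not_ge
  · exact ⟨g, ρ, hqρ, hρ, h⟩

end Pieces

/-! ### Blow-ups in a fixed ball and compactness of the copies -/

theorem eventually_exists_blowUp_inter_ball_eq {E : Type*} [NormedAddCommGroup E]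
    [NormedSpace ℝ E] {m : ℕ} {φ : Fin m → E → E} {r : Fin m → ℝ≥0} {C : Closeds E}
    (hφ : ∀ i, ScalesBy (φ i) (r i)) (hr : ∀ i, r i ≠ 0) (hr1 : ∀ i, r i < 1)
    (heq : (C : Set E) = ⋃ i, φ i '' C) {δ : ℝ≥0} (hδ0 : 0 < δ)
    (hδ : ∀ i j, i ≠ j → ∀ y ∈ (C : Set E), ∀ z ∈ (C : Set E), (δ : ℝ) ≤ dist (φ i y) (φ j z))
    {x : E} (hx : x ∈ C) {R : ℝ≥0} (hR : 0 < R) :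
    ∃ A B : ℝ≥0, 0 < A ∧ ∀ᶠ t in atTop, ∃ (ψ : C → E) (ρ : ℝ≥0), ρ ∈ Icc A B ∧ ScalesBy ψ ρ ∧
      0 ∈ range ψ ∧
      (blowUp C x t : Set E) ∩ Metric.ball 0 R = range ψ ∩ Metric.ball 0 R := by
  obtain ⟨a, ha, har⟩ : ∃ a : ℝ≥0, 0 < a ∧ ∀ i, a ≤ r i := by
    have h1 : ∀ᶠ a : ℝ≥0 in 𝓝[>] 0, ∀ i, a ≤ r i := eventually_all.2 fun i =>
      nhdsWithin_le_nhds (Iic_mem_nhds (pos_iff_ne_zero.2 (hr i)))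
    obtain ⟨a, h2, h3⟩ := (h1.and (self_mem_nhdsWithin : Ioi (0 : ℝ≥0) ∈ 𝓝[>] 0)).exists
    exact ⟨a, h3, h2⟩
  refine ⟨R / δ, R / δ / a, by positivity, ?_⟩
  filter_upwards [Real.tendsto_exp_atTop.eventually_ge_atTop ((R / δ : ℝ≥0) : ℝ)] with t ht
  let e : ℝ≥0 := ⟨Real.exp t, (Real.exp_pos t).le⟩
  have he : 0 < e := Real.exp_pos t
  have het : (e : ℝ) = Real.exp t := rfl
  have hRe : R / δ ≤ e := ht
  -- This scale makes `δ * ρ ≥ R / e`, the radius of the window before magnification, and puts `e *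
  -- ρ` between `R / δ` and `R / δ / a`. It is at most `1` because `t` is large.
  obtain ⟨g, ρ, hqρ, hρq, hg, hxg, hgC, hball⟩ := exists_scalesBy_inter_ball_subset hφ hr1 heq hδ
    ha har (show x ∈ (C : Set E) from hx) (q := R / δ / e) (by positivity)
    ((div_le_one he).2 hRe)
  have hRρ : R / e ≤ δ * ρ := by
    calc R / e = δ * (R / δ / e) := by field_simp
      _ ≤ δ * ρ := by gcongr
  refine ⟨fun y => Real.exp t • (g y - x), e * ρ, ⟨?_, ?_⟩, ?_, ?_, ?_⟩
  · calc R / δ = e * (R / δ / e) := by field_simp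
      _ ≤ e * ρ := by gcongr
  · calc e * ρ ≤ e * (R / δ / e / a) := by gcongr
      _ = R / δ / a := by field_simp
  · intro y z
    rw [dist_smul₀, dist_sub_right, hg, Real.norm_of_nonneg (Real.exp_pos t).le, ← het,
      NNReal.coe_mul, mul_assoc, Subtype.dist_eq]
  · obtain ⟨c, hc, rfl⟩ := hxg
    exact ⟨⟨c, hc⟩, by simp⟩
  · ext z
    refine and_congr_left fun hz => ⟨?_, ?_⟩
    · rintro ⟨y, hy, rfl⟩
      have hyx : dist y x < δ * ρ := by
        rw [mem_ball_zero_iff, norm_smul, Real.norm_of_nonneg (Real.exp_pos t).le,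
          ← dist_eq_norm, ← het, mul_comm, ← lt_div_iff₀ (by exact_mod_cast he)] at hz
        exact hz.trans_le (by exact_mod_cast hRρ)
      obtain ⟨c, hc, rfl⟩ := hball ⟨hy, hyx⟩
      exact ⟨⟨c, hc⟩, rfl⟩
    · rintro ⟨c, rfl⟩
      exact ⟨g c, hgC ⟨c, c.2, rfl⟩, rfl⟩

/-- Maps from a compact space scaling distances by factors in a compact interval, with zeros,
subconverge uniformly. -/
theorem ScalesBy.exists_tendstoUniformly {X E : Type*} [MetricSpace X] [CompactSpace X]
    [NormedAddCommGroup E] [ProperSpace E] {ψ : ℕ → X → E} {ρ : ℕ → ℝ≥0} {A B : ℝ≥0}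
    (hρ : ∀ n, ρ n ∈ Icc A B) (hψ : ∀ n, ScalesBy (ψ n) (ρ n)) (h0 : ∀ n, 0 ∈ range (ψ n)) :
    ∃ (σ : ℕ → ℕ) (ψ' : X → E) (ρ' : ℝ≥0), StrictMono σ ∧ ρ' ∈ Icc A B ∧ ScalesBy ψ' ρ' ∧
      Tendsto (ρ ∘ σ) atTop (𝓝 ρ') ∧ TendstoUniformly (fun n => ψ (σ n)) ψ' atTop := by
  let Ψ : ℕ → BoundedContinuousFunction X E := fun n =>
    BoundedContinuousFunction.mkOfCompact ⟨ψ n, (hψ n).lipschitz.continuous⟩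
  -- The zeros together with the Lipschitz bound `B` confine all values to one closed ball; the same
  -- bound gives equicontinuity.
  have hcomp : IsCompact (closure (range Ψ)) := by
    refine BoundedContinuousFunction.arzela_ascoli
      (Metric.closedBall 0 (B * Metric.diam (univ : Set X))) (isCompact_closedBall _ _) _ ?_ ?_
    · rintro _ y ⟨n, rfl⟩
      obtain ⟨z, hz⟩ := h0 n
      have h1 : dist (ψ n y) 0 = ρ n * dist y z := by rw [← hz, hψ n]
      refine Metric.mem_closedBall.2 (h1.trans_le ?_)
      have := Metric.dist_le_diam_of_mem isCompact_univ.isBounded (mem_univ y) (mem_univ z)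
      have hB : (ρ n : ℝ) ≤ B := by exact_mod_cast (hρ n).2
      gcongr
    · refine (LipschitzWith.uniformEquicontinuous _ B ?_).equicontinuous
      rintro ⟨_, n, rfl⟩
      exact (hψ n).lipschitz.weaken (hρ n).2
  obtain ⟨Ψ', -, σ, hσ, hΨ⟩ := hcomp.tendsto_subseq fun n => subset_closure (mem_range_self n)
  obtain ⟨ρ', hρ', τ, hτ, hρτ⟩ := (isCompact_Icc (a := A) (b := B)).tendsto_subseq
    fun n => hρ (σ n)
  have hu : TendstoUniformly (fun n => ψ (σ (τ n))) Ψ' atTop :=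
    BoundedContinuousFunction.tendsto_iff_tendstoUniformly.1 (hΨ.comp hτ.tendsto_atTop)
  refine ⟨σ ∘ τ, Ψ', ρ', hσ.comp hτ, hρ', fun y z => ?_, hρτ, hu⟩
  have h1 := ((hu.tendsto_at y).dist (hu.tendsto_at z))
  have h2 := ((NNReal.continuous_coe.tendsto ρ').comp hρτ).mul_const (dist y z)
  refine tendsto_nhds_unique h1 (h2.congr fun n => ?_)
  simp [hψ (σ (τ n)) y z]

/-! ### Fell limits and uniform limits -/

section Fell

variable {E : Type*} [TopologicalSpace E] {ι : Type*} {l : Filter ι} {S : ι → Closeds E}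
  {F : Closeds E}

theorem eventually_inter_nonempty_of_tendsto_fell (h : Tendsto S l (@nhds _ (fellTopology E) F))
    {G : Set E} (hG : IsOpen G) (hFG : ((F : Set E) ∩ G).Nonempty) :
    ∀ᶠ k in l, ((S k : Set E) ∩ G).Nonempty :=
  h.eventually (@IsOpen.mem_nhds _ (fellTopology E) F
    {F : Closeds E | ((F : Set E) ∩ G).Nonempty} (isOpen_generateFrom_of_mem (Or.inr ⟨G, hG, rfl⟩)) hFG)

theorem eventually_inter_eq_empty_of_tendsto_fell (h : Tendsto S l (@nhds _ (fellTopology E) F))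
    {K : Set E} (hK : IsCompact K) (hFK : (F : Set E) ∩ K = ∅) :
    ∀ᶠ k in l, (S k : Set E) ∩ K = ∅ :=
  h.eventually (@IsOpen.mem_nhds _ (fellTopology E) F
    {F : Closeds E | (F : Set E) ∩ K = ∅} (isOpen_generateFrom_of_mem (Or.inl ⟨K, hK, rfl⟩)) hFK)

end Fell

/-- If the sets agree with the ranges of uniformly convergent maps in an open set, then so does
the Fell limit. -/
theorem inter_eq_of_tendsto_fell {X E : Type*} [TopologicalSpace X] [CompactSpace X]
    [MetricSpace E] [ProperSpace E] {ι : Type*} {l : Filter ι} [l.NeBot] {S : ι → Closeds E}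
    {F : Closeds E} (h : Tendsto S l (@nhds _ (fellTopology E) F)) {ψ : ι → X → E} {ψ' : X → E}
    (hψ' : Continuous ψ') (hψ : TendstoUniformly ψ ψ' l) {U : Set E} (hU : IsOpen U)
    (hS : ∀ᶠ k in l, (S k : Set E) ∩ U = range (ψ k) ∩ U) :
    (F : Set E) ∩ U = range ψ' ∩ U := by
  ext y
  refine and_congr_left fun hyU => ⟨fun hy => ?_, ?_⟩
  · have hcl : IsClosed (range ψ') := (isCompact_range hψ').isClosed
    rw [← hcl.closure_eq, Metric.mem_closure_iff]
    intro ε hε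
    have hε2 : 0 < ε / 2 := half_pos hε
    obtain ⟨k, ⟨z, hzS, hzy, hzU⟩, hk, hSk⟩ := ((eventually_inter_nonempty_of_tendsto_fell h
      (Metric.isOpen_ball.inter hU) ⟨y, hy, Metric.mem_ball_self hε2, hyU⟩).and
      ((Metric.tendstoUniformly_iff.1 hψ _ hε2).and hS)).exists
    obtain ⟨⟨c, rfl⟩, -⟩ := hSk.subset ⟨hzS, hzU⟩
    refine ⟨ψ' c, mem_range_self c, ?_⟩
    have h1 := hk c
    have h2 : dist (ψ k c) y < ε / 2 := hzy
    rw [dist_comm] at h1 h2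
    linarith [dist_triangle y (ψ k c) (ψ' c)]
  · rintro ⟨c, rfl⟩
    -- A small closed ball about `ψ' c` would miss `F`, hence eventually `S k`, although it contains
    -- the point `ψ k c` of `S k`.
    by_contra hF
    obtain ⟨ε, hε, hball⟩ := Metric.nhds_basis_closedBall.mem_iff.1
      (F.isClosed.isOpen_compl.mem_nhds hF)
    have hlim := hψ.tendsto_at c
    obtain ⟨k, hk1, hk2, hk3, hSk⟩ := ((eventually_inter_eq_empty_of_tendsto_fell h
      (isCompact_closedBall (ψ' c) ε) (disjoint_iff_inter_eq_empty.1
        (disjoint_left.2 fun z hz hz' => hball hz' hz))).and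
      ((hlim.eventually (Metric.closedBall_mem_nhds _ hε)).and ((hlim.eventually (hU.mem_nhds hyU)).and hS))).exists
    exact (eq_empty_iff_forall_notMem.1 hk1) _ ⟨(hSk.superset ⟨mem_range_self c, hk3⟩).1, hk2⟩

/-! ### Hausdorff measure on similar copies -/

section Image

variable {X E : Type*} [MetricSpace X] [MeasurableSpace X] [BorelSpace X]
  [MetricSpace E] [MeasurableSpace E] [BorelSpace E]

theorem ScalesBy.restrict_range_hausdorffMeasure {ψ : X → E} {ρ : ℝ≥0} (h : ScalesBy ψ ρ)
    (hρ : ρ ≠ 0) {s : ℝ} (hs : 0 ≤ s) :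
    (μH[s] : Measure E).restrict (range ψ) = (ρ : ℝ≥0∞) ^ s • (μH[s] : Measure X).map ψ := by
  have hc : Continuous ψ := h.lipschitz.continuous
  ext B hB
  rw [Measure.restrict_apply hB, Measure.smul_apply, Measure.map_apply hc.measurable hB,
    smul_eq_mul, ← h.hausdorffMeasure_image hρ hs, image_preimage_eq_inter_range]

theorem ScalesBy.setIntegral_range {ψ : X → E} {ρ : ℝ≥0} (h : ScalesBy ψ ρ)
    (hρ : ρ ≠ 0) {s : ℝ} (hs : 0 ≤ s) {f : E → ℝ} (hf : Continuous f) :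
    ∫ y in range ψ, f y ∂μH[s] = (ρ : ℝ) ^ s * ∫ c, f (ψ c) ∂μH[s] := by
  have hc : Continuous ψ := h.lipschitz.continuous
  rw [h.restrict_range_hausdorffMeasure hρ hs, integral_smul_measure,
    integral_map_of_stronglyMeasurable hc.measurable hf.measurable.stronglyMeasurable,
    ← ENNReal.toReal_rpow, ENNReal.coe_toReal, smul_eq_mul]

/-- Pulling back to `X` turns integrals over moving sets into integrals against one finite measure,
where a bound for `f` dominates. -/
theorem ScalesBy.tendsto_setIntegral_range (s : ℝ) (hs : 0 ≤ s) (hfin : μH[s] (univ : Set X) < ⊤)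
    {ψ : ℕ → X → E} {ρ : ℕ → ℝ≥0} {ψ' : X → E} {ρ' : ℝ≥0} (hψ : ∀ n, ScalesBy (ψ n) (ρ n))
    (hψ' : ScalesBy ψ' ρ') (hρ : ∀ n, ρ n ≠ 0) (hρ' : ρ' ≠ 0) (hρlim : Tendsto ρ atTop (𝓝 ρ'))
    (hlim : ∀ c, Tendsto (fun n => ψ n c) atTop (𝓝 (ψ' c))) {f : E → ℝ} (hf : Continuous f)
    (hfc : HasCompactSupport f) :
    Tendsto (fun n => ∫ y in range (ψ n), f y ∂μH[s]) atTop
      (𝓝 (∫ y in range ψ', f y ∂μH[s])) := by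
  have : IsFiniteMeasure (μH[s] : Measure X) := ⟨hfin⟩
  obtain ⟨M, hM⟩ := hf.bounded_above_of_compact_support hfc
  simp_rw [fun n => (hψ n).setIntegral_range (hρ n) hs hf, hψ'.setIntegral_range hρ' hs hf]
  refine Tendsto.mul ?_ ?_
  · exact ((NNReal.continuous_coe.tendsto ρ').comp hρlim).rpow_const
      (Or.inl (by exact_mod_cast hρ'))
  · refine tendsto_integral_of_dominated_convergence (fun _ => M) (fun n => ?_)
      (integrable_const M) (fun n => Eventually.of_forall fun c => hM _)
      (Eventually.of_forall fun c => (hf.tendsto _).comp (hlim c))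
    exact (hf.comp (hψ n).lipschitz.continuous).measurable.aestronglyMeasurable

end Image

/-! ### Convergence of the blow-up measures -/

theorem setIntegral_eq_of_inter_eq {X : Type*} [MeasurableSpace X] {μ : Measure X} {S T U : Set X}
    (hS : MeasurableSet S) (hT : MeasurableSet T) (h : S ∩ U = T ∩ U) {f : X → ℝ}
    (hf : ∀ y ∉ U, f y = 0) : ∫ y in S, f y ∂μ = ∫ y in T, f y ∂μ := by
  rw [← integral_indicator hS, ← integral_indicator hT]
  congr 1
  ext y
  by_cases hy : y ∈ U
  · have : y ∈ S ↔ y ∈ T := by simpa [hy] using Set.ext_iff.1 h y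
    by_cases hyS : y ∈ S
    · simp [hyS, this.1 hyS]
    · simp [hyS, mt this.2 hyS]
  · simp [indicator, hf y hy]

theorem scalesBy_blowUp {E : Type*} [NormedAddCommGroup E] [NormedSpace ℝ E] (x : E) (t : ℝ) :
    ScalesBy (fun y : E => Real.exp t • (y - x)) (Real.exp t).toNNReal := fun y z => by
  rw [dist_smul₀, dist_sub_right, Real.norm_of_nonneg (Real.exp_pos t).le,
    Real.coe_toNNReal _ (Real.exp_pos t).le]

theorem regular_restrict_of_forall_ball {E : Type*} [NormedAddCommGroup E] [ProperSpace E]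
    [MeasurableSpace E] [BorelSpace E] {μ : Measure E} {F : Set E}
    (h : ∀ R : ℝ≥0, 0 < R → μ (F ∩ Metric.ball 0 R) < ⊤) : (μ.restrict F).Regular := by
  have : IsLocallyFiniteMeasure (μ.restrict F) := by
    refine ⟨fun y => ⟨Metric.ball 0 (‖y‖₊ + 1 : ℝ≥0), Metric.isOpen_ball.mem_nhds ?_, ?_⟩⟩
    · simp
    · rw [Measure.restrict_apply Metric.isOpen_ball.measurableSet, inter_comm]
      exact h _ (by positivity)
  infer_instance

theorem radonWeakTendsto_blowUp {E : Type*} [NormedAddCommGroup E] [NormedSpace ℝ E]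
    [ProperSpace E] [MeasurableSpace E] [BorelSpace E] {m : ℕ} {φ : Fin m → E → E}
    {r : Fin m → ℝ≥0} {C : Closeds E}
    (hφ : ∀ i, ScalesBy (φ i) (r i)) (hr : ∀ i, r i ≠ 0) (hr1 : ∀ i, r i < 1)
    (hC : IsCompact (C : Set E)) (heq : (C : Set E) = ⋃ i, φ i '' C) {δ : ℝ≥0} (hδ0 : 0 < δ)
    (hδ : ∀ i j, i ≠ j → ∀ y ∈ (C : Set E), ∀ z ∈ (C : Set E), (δ : ℝ) ≤ dist (φ i y) (φ j z))
    {s : ℝ} (hs : 0 ≤ s) (hfin : μH[s] (C : Set E) < ⊤) {x : E} (hx : x ∈ C) {t : ℕ → ℝ}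
    (ht : Tendsto t atTop atTop) {F : Closeds E}
    (hF : Tendsto (fun k => blowUp C x (t k)) atTop (@nhds _ (fellTopology E) F)) :
    RadonWeakTendsto (fun k => μH[s].restrict (blowUp C x (t k) : Set E))
      (μH[s].restrict (F : Set E)) := by
  have : CompactSpace C := isCompact_iff_compactSpace.1 hC
  have hfinC : μH[s] (univ : Set C) < ⊤ := by
    rw [← isometry_subtype_coe.hausdorffMeasure_image (Or.inl hs), image_univ,
      Subtype.range_coe]
    exact hfin
  have key : ∀ R : ℝ≥0, 0 < R → ∀ ns : ℕ → ℕ, Tendsto ns atTop atTop →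
      ∃ (σ : ℕ → ℕ) (ψ : ℕ → C → E) (ρ : ℕ → ℝ≥0) (ψ' : C → E) (ρ' : ℝ≥0),
        (∀ n, ScalesBy (ψ n) (ρ n)) ∧ ScalesBy ψ' ρ' ∧ (∀ n, ρ n ≠ 0) ∧ ρ' ≠ 0 ∧
        Tendsto ρ atTop (𝓝 ρ') ∧ (∀ c, Tendsto (fun n => ψ n c) atTop (𝓝 (ψ' c))) ∧
        (∀ n, (blowUp C x (t (ns (σ n))) : Set E) ∩ Metric.ball 0 R =
          range (ψ n) ∩ Metric.ball 0 R) ∧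
        (F : Set E) ∩ Metric.ball 0 R = range ψ' ∩ Metric.ball 0 R := by
    intro R hR ns hns
    obtain ⟨A, B, hA, hev⟩ := eventually_exists_blowUp_inter_ball_eq hφ hr hr1 heq hδ0 hδ hx hR
    obtain ⟨N, hN⟩ := eventually_atTop.1 ((ht.comp hns).eventually hev)
    -- The shift by `N` makes the local description valid at every index.
    choose ψ ρ hρ hψ h0 hψS using fun n => hN (n + N) (Nat.le_add_left N n)
    obtain ⟨σ, ψ', ρ', hσ, hρ', hψ', hρlim, hu⟩ := ScalesBy.exists_tendstoUniformly hρ hψ h0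
    refine ⟨fun n => σ n + N, fun n => ψ (σ n), ρ ∘ σ, ψ', ρ', fun n => hψ _, hψ',
      fun n => (hA.trans_le (hρ _).1).ne', (hA.trans_le hρ'.1).ne', hρlim, hu.tendsto_at,
      fun n => hψS _, ?_⟩
    have hsub : Tendsto (fun n => ns (σ n + N)) atTop atTop :=
      hns.comp ((tendsto_add_atTop_nat N).comp hσ.tendsto_atTop)
    exact inter_eq_of_tendsto_fell (hF.comp hsub) hψ'.lipschitz.continuous hu Metric.isOpen_ball
      (Eventually.of_forall fun n => hψS _)
  refine ⟨fun k => regular_restrict_of_forall_ball fun R _ => ?_,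
    regular_restrict_of_forall_ball fun R hR => ?_, fun f hf hfc => ?_⟩
  · refine (measure_mono inter_subset_left).trans_lt ?_
    have h1 := (scalesBy_blowUp x (t k)).hausdorffMeasure_image
      (Real.toNNReal_pos.2 (Real.exp_pos (t k))).ne' hs (C : Set E)
    refine h1.trans_lt (ENNReal.mul_lt_top ?_ hfin)
    exact ENNReal.rpow_lt_top_of_nonneg hs ENNReal.coe_ne_top
  · obtain ⟨-, -, -, ψ', ρ', -, hψ', -, hρ', -, -, -, hFψ⟩ := key R hR id tendsto_id
    rw [hFψ]
    refine (measure_mono inter_subset_left).trans_lt ?_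
    rw [← image_univ, hψ'.hausdorffMeasure_image hρ' hs]
    exact ENNReal.mul_lt_top (ENNReal.rpow_lt_top_of_nonneg hs ENNReal.coe_ne_top) hfinC
  · obtain ⟨R, hR, hfR⟩ : ∃ R : ℝ≥0, 0 < R ∧ ∀ y ∉ Metric.ball (0 : E) R, f y = 0 := by
      obtain ⟨R, hR, hsub⟩ := hfc.isCompact.isBounded.subset_ball_lt 0 0
      refine ⟨⟨R, hR.le⟩, hR, fun y hy => image_eq_zero_of_notMem_tsupport fun h => hy (hsub h)⟩
    -- The limiting copy may depend on the subsequence, but its integral of `f` is always that over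
    -- `F`; hence the full sequence converges.
    refine tendsto_of_subseq_tendsto fun ns hns => ?_
    obtain ⟨σ, ψ, ρ, ψ', ρ', hψ, hψ', hρ, hρ', hρlim, hlim, hS, hFψ⟩ := key R hR ns hns
    refine ⟨σ, ?_⟩
    have hmeas : ∀ {g : C → E} {q : ℝ≥0}, ScalesBy g q → MeasurableSet (range g) := fun hg =>
      (isCompact_range hg.lipschitz.continuous).measurableSet
    rw [setIntegral_eq_of_inter_eq F.isClosed.measurableSet (hmeas hψ') hFψ hfR]
    simp_rw [fun n => setIntegral_eq_of_inter_eq (μ := μH[s])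
      (blowUp C x (t (ns (σ n)))).isClosed.measurableSet (hmeas (hψ n)) (hS n) hfR]
    exact ScalesBy.tendsto_setIntegral_range s hs hfinC hψ hψ' hρ hρ' hρlim hlim hf hfc

theorem theorem4p1 (d m : ℕ)
    (φ : Fin m → EuclideanSpace ℝ (Fin d) → EuclideanSpace ℝ (Fin d))
    (C : Closeds (EuclideanSpace ℝ (Fin d)))
    (hC : IsSelfSimilarSet φ (C : Set (EuclideanSpace ℝ (Fin d))))
    (hsep : StrongSeparation φ (C : Set (EuclideanSpace ℝ (Fin d))))
    (hplane : ∀ P : AffineSubspace ℝ (EuclideanSpace ℝ (Fin d)), IsHyperplane P →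
      ¬ ((C : Set (EuclideanSpace ℝ (Fin d))) ⊆ P))
    (s : ℝ) (hs : s = (dimH (C : Set (EuclideanSpace ℝ (Fin d)))).toReal)
    (x : EuclideanSpace ℝ (Fin d)) (hx : x ∈ C)
    (t : ℕ → ℝ) (ht : Tendsto t atTop atTop)
    (F : Closeds (EuclideanSpace ℝ (Fin d)))
    (hF : Tendsto (fun k => blowUp C x (t k)) atTop
      (@nhds _ (fellTopology (EuclideanSpace ℝ (Fin d))) F)) :
    ∃ σ : ℕ → ℕ, StrictMono σ ∧
      RadonWeakTendsto
        (fun k => (Measure.hausdorffMeasure s).restrict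
          (blowUp C x (t (σ k)) : Set (EuclideanSpace ℝ (Fin d))))
        ((Measure.hausdorffMeasure s).restrict (F : Set (EuclideanSpace ℝ (Fin d)))) := by
  choose q hq0 hq1 hq using hC.similitude
  let r : Fin m → ℝ≥0 := fun i => ⟨q i, (hq0 i).le⟩
  have hφ : ∀ i, ScalesBy (φ i) (r i) := hq
  have hr : ∀ i, r i ≠ 0 := fun i => (show 0 < r i from hq0 i).ne'
  obtain ⟨δ, hδ0, hδ⟩ := hsep.exists_le_dist hC.isCompact fun i => (hφ i).lipschitz.continuous
  have hfin := hausdorffMeasure_dimH_lt_top hφ hr hq1 hC.isCompact hC.nonempty hC.eq_iUnion hδ0 hδ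
    (Real.dimH_ne_top _)
  rw [← hs] at hfin
  -- No extraction is needed: Fell convergence already forces weak convergence of the whole
  -- sequence.
  exact ⟨id, strictMono_id, radonWeakTendsto_blowUp hφ hr hq1 hC.isCompact hC.eq_iUnion hδ0 hδ
    (hs ▸ ENNReal.toReal_nonneg) hfin hx ht hF⟩
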